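/- A GF(2)-grammar over a finite alphabet $\Sigma$ is an ordinary context-free grammar $G$ (finitely many nonterminals, an initial nonterminal $S$, and a finite set of rules $A \to X_1 \cdots X_\ell$ with $\ell \geqslant 0$ and each $X_i$ a terminal or a nonterminal) such that every string $w \in \Sigma^*$ has only finitely many parse trees with root $S$. The language described by such a grammar is the set of all strings $w \in \Sigma^*$ for which the number of parse trees of $w$ with root $S$ is odd. **Theorem.** Let $a \neq b$ be two symbols of an alphabet. Then the language $\{\, a^{2^n} b^{2^n} \mid n \in \mathbb{N},\ n \geqslant 0 \,\}$ is not described by any GF(2)-grammar. -/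

import Mathlib

/-- Ordered parse forests of a context-free grammar `G` over a sentential form `X₁ … X_ℓ`: for every
terminal `X_i` the forest has a leaf, and for every nonterminal `X_i = A` it has a parse tree with
root `A`, given by a rule `A → γ` of `G` together with the forest over `γ` of the root's subtrees. -/
inductive ContextFreeGrammar.ParseForest {T : Type*} (G : ContextFreeGrammar T) :
    List (Symbol T G.NT) → Type _
  | nil : ContextFreeGrammar.ParseForest G []
  | leaf (t : T) {α : List (Symbol T G.NT)} (rest : ContextFreeGrammar.ParseForest G α) :
      ContextFreeGrammar.ParseForest G (Symbol.terminal t :: α)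
  | node (A : G.NT) (γ : List (Symbol T G.NT)) (rule_mem : ContextFreeRule.mk A γ ∈ G.rules)
      (children : ContextFreeGrammar.ParseForest G γ)
      {α : List (Symbol T G.NT)} (rest : ContextFreeGrammar.ParseForest G α) :
      ContextFreeGrammar.ParseForest G (Symbol.nonterminal A :: α)

/-- The string of terminals at the leaves of a parse forest, read from left to right. -/
def ContextFreeGrammar.ParseForest.yield {T : Type*} {G : ContextFreeGrammar T} :
    {α : List (Symbol T G.NT)} → G.ParseForest α → List T
  | _, .nil => []
  | _, .leaf t rest => t :: rest.yield
  | _, .node _ _ _ children rest => children.yield ++ rest.yield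

/-- A parse tree with root `A`: a forest over the one-symbol sentential form `A`. -/
abbrev ContextFreeGrammar.ParseTree {T : Type*} (G : ContextFreeGrammar T) (A : G.NT) : Type _ :=
  G.ParseForest [Symbol.nonterminal A]

/-- The set of all parse trees of the string `w` as `A`. -/
def ContextFreeGrammar.parseTrees {T : Type*} (G : ContextFreeGrammar T) (A : G.NT)
    (w : List T) : Set (G.ParseTree A) :=
  {t | t.yield = w}

/-- A GF(2)-grammar over the alphabet `T`. Syntactically it is an ordinary grammar (`A → γ` stands
for the rule in which the symbols of `γ` are joined by GF(2)-concatenation), and every string must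
have only finitely many parse trees in that ordinary grammar. -/
structure GF2Grammar (T : Type*) extends ContextFreeGrammar T where
  finite_parseTrees : ∀ w : List T,
    (toContextFreeGrammar.parseTrees toContextFreeGrammar.initial w).Finite

/-- The language described by a GF(2)-grammar: all strings with an odd number of parse trees as the
initial symbol. -/
def GF2Grammar.language {T : Type*} (G : GF2Grammar T) : Language T :=
  {w | Odd (G.parseTrees G.initial w).ncard}

/-- A language is described by a GF(2)-grammar. -/
def Language.IsGF2 {T : Type*} (L : Language T) : Prop :=
  ∃ G : GF2Grammar T, G.language = L

/-!
Let `d α` be the generating series of the number of parse forests over `α` of the strings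
`a ^ i * b ^ (j + 1)`. If such a string is split into two, then either the first part is a power of
`a` and the second one contains `b`, or the first part contains `b` and the second one is a power of
`b`. Hence `d` is a twisted derivation, `d (X α) = p X * d α + d X * q α`, with `p X` a series in
the first variable and `q α` a series in the second one, and the rules of the grammar turn into a
linear system for the `d X`, whose coefficients have finite rank: they are finite sums of products
`f(X) * g(Y)`.

Wherever the constant term of the matrix of this system is not zero, a parse tree can be enlarged
without changing its yield. By finite ambiguity this constant term is then nilpotent, so that the
determinant `D` of the system is not zero. By Cramer's rule `D * B` has finite rank, where `B` is
the series of the language modulo 2. But if `B = ∑ j ∈ S, X ^ j * Y ^ j` with `S` infinite and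
lacunary, then the coefficients of `D * B` combine the shifts by `X ^ j`, `j ∈ S`, of a
finite-dimensional space, and these shifts are linearly independent once the gaps are large.
-/

/-! ### Linear systems over a subring -/

section Subring

open Matrix

variable {n R : Type*} [Fintype n] [DecidableEq n] [CommRing R]

theorem det_mem_subring (A : Subring R) {M : Matrix n n R} (hM : ∀ i j, M i j ∈ A) : M.det ∈ A := by
  rw [det_apply]
  exact sum_mem fun σ _ => zsmul_mem (prod_mem fun i _ => hM _ _) _

theorem det_mul_mem_of_mulVec_mem (A : Subring R) {M : Matrix n n R} (hM : ∀ i j, M i j ∈ A)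
    {v : n → R} (hv : ∀ i, (M *ᵥ v) i ∈ A) (i : n) : M.det * v i ∈ A := by
  have cramer : M.adjugate *ᵥ (M *ᵥ v) = M.det • v := by
    rw [mulVec_mulVec, adjugate_mul, smul_mulVec, one_mulVec]
  have adjugate_mem (j : n) : M.adjugate i j ∈ A := by
    rw [adjugate_apply]
    refine det_mem_subring A fun k l => ?_
    rw [updateRow_apply, Pi.single_apply]
    split_ifs <;> simp only [one_mem, zero_mem, hM]
  rw [← smul_eq_mul, ← Pi.smul_apply, ← cramer]
  exact sum_mem fun j _ => mul_mem (adjugate_mem j) (hv j)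

end Subring

theorem det_one_sub_ne_zero_of_rank {n K : Type*} [Fintype n] [DecidableEq n] [CommRing K]
    [IsDomain K] {M : Matrix n n K} (rank : n → ℕ) (hM : ∀ i j, M i j ≠ 0 → rank j < rank i) :
    (1 - M).det ≠ 0 := by
  intro hdet
  obtain ⟨v, hv, hMv⟩ := Matrix.exists_mulVec_eq_zero_iff.2 hdet
  obtain ⟨i, hi, hmin⟩ := (measure rank).wf.has_min {i | v i ≠ 0} (Function.ne_iff.1 hv)
  rw [Matrix.sub_mulVec, Matrix.one_mulVec, sub_eq_zero] at hMv
  rw [Set.mem_ofPred_eq, hMv] at hi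
  obtain ⟨j, -, hj⟩ := Finset.exists_ne_zero_of_sum_ne_zero hi
  exact hmin j (right_ne_zero_of_mul hj) (hM i j (left_ne_zero_of_mul hj))

section LeibnizSum

variable {σ R : Type*} [CommRing R]

/-- The value on a word of the `(l, r)`-derivation of the free monoid that sends each letter `X` to
`d X`: the sum of `(∏ l) * d X * (∏ r)` over the occurrences of letters `X` in the word, with `l`
applied to the letters before the occurrence and `r` to the letters after it. -/
def leibnizSum (l r d : σ → R) : List σ → R
  | [] => 0
  | X :: α => l X * leibnizSum l r d α + d X * (α.map r).prod

theorem map_leibnizSum {S : Type*} [CommRing S] (f : R →+* S) (l r d : σ → R) (α : List σ) :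
    f (leibnizSum l r d α) = leibnizSum (f ∘ l) (f ∘ r) (f ∘ d) α := by
  induction α with
  | nil => simp [leibnizSum]
  | cons X α ih => simp [leibnizSum, ih, map_list_prod]

theorem leibnizSum_mem (A : Subring R) {l r d : σ → R} (hl : ∀ X, l X ∈ A) (hr : ∀ X, r X ∈ A)
    (hd : ∀ X, d X ∈ A) (α : List σ) : leibnizSum l r d α ∈ A := by
  induction α with
  | nil => exact zero_mem A
  | cons X α ih =>
    exact add_mem (mul_mem (hl X) ih) <|
      mul_mem (hd X) (list_prod_mem (by simpa using fun Y _ => hr Y))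

variable [DecidableEq σ]

theorem leibnizSum_sub_sum_mem (A : Subring R) {l r d : σ → R} (hl : ∀ X, l X ∈ A)
    (hr : ∀ X, r X ∈ A) (s : Finset σ) {α : List σ} (hd : ∀ X ∈ α, X ∉ s → d X ∈ A) :
    leibnizSum l r d α - ∑ Y ∈ s, leibnizSum l r (Pi.single Y 1) α * d Y ∈ A := by
  induction α with
  | nil => simp [leibnizSum]
  | cons X α ih =>
    rw [List.forall_mem_cons] at hd
    have head_mem : d X - ∑ Y ∈ s, Pi.single (M := fun _ => R) Y 1 X * d Y ∈ A := by
      by_cases hX : X ∈ s <;> simp [Pi.single_apply, hX, hd.1]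
    have tail_mem : (α.map r).prod ∈ A := list_prod_mem (by simpa using fun Y _ => hr Y)
    convert add_mem (mul_mem (hl X) (ih hd.2)) (mul_mem head_mem tail_mem) using 1
    simp only [leibnizSum, add_mul, Finset.sum_add_distrib, mul_sub, sub_mul, Finset.mul_sum,
      Finset.sum_mul, mul_assoc, mul_comm (List.prod _)]
    ring

/-- The matrix of the linear system `d X = ∑ α ∈ P X, leibnizSum l r d α`, `X ∈ s`, of a grammar
with right-hand sides `P X`, in the unknowns `d Y`, `Y ∈ s`. -/
def jacobian (P : σ → Finset (List σ)) (s : Finset σ) (l r : σ → R) : Matrix s s R :=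
  .of fun X Y => ∑ α ∈ P X, leibnizSum l r (Pi.single Y.1 1) α

theorem map_det_one_sub_jacobian {S : Type*} [CommRing S] (f : R →+* S) (P : σ → Finset (List σ))
    (s : Finset σ) (l r : σ → R) :
    f (1 - jacobian P s l r).det = (1 - jacobian P s (f ∘ l) (f ∘ r)).det := by
  have map_single (Y : σ) : f ∘ Pi.single Y 1 = Pi.single Y 1 := by
    ext X
    simp [Pi.single_apply, apply_ite f]
  have map_jacobian : (jacobian P s l r).map f = jacobian P s (f ∘ l) (f ∘ r) := by
    ext X Y
    simp [jacobian, map_leibnizSum, map_single]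
  rw [RingHom.map_det, map_sub, map_one, RingHom.mapMatrix_apply, map_jacobian]

theorem one_sub_jacobian_mem (A : Subring R) (P : σ → Finset (List σ)) (s : Finset σ)
    {l r : σ → R} (hl : ∀ X, l X ∈ A) (hr : ∀ X, r X ∈ A) (X Y : s) :
    (1 - jacobian P s l r) X Y ∈ A := by
  refine sub_mem ?_ (sum_mem fun α _ => leibnizSum_mem A hl hr (fun Z => ?_) α)
  · rw [Matrix.one_apply]
    split_ifs <;> simp only [one_mem, zero_mem]
  · rw [Pi.single_apply]
    split_ifs <;> simp only [one_mem, zero_mem]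

open Matrix in
theorem det_one_sub_jacobian_mul_mem (A : Subring R) {P : σ → Finset (List σ)} {s : Finset σ}
    {l r d : σ → R} (hl : ∀ X, l X ∈ A) (hr : ∀ X, r X ∈ A)
    (hd : ∀ X ∈ s, d X = ∑ α ∈ P X, leibnizSum l r d α)
    (hP : ∀ X ∈ s, ∀ α ∈ P X, ∀ Y ∈ α, Y ∉ s → d Y ∈ A) {X : σ} (hX : X ∈ s) :
    (1 - jacobian P s l r).det * d X ∈ A := by
  refine det_mul_mem_of_mulVec_mem A (one_sub_jacobian_mem A P s hl hr) (v := fun Y => d Y)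
    (fun X => ?_) ⟨X, hX⟩
  have mulVec_eq : ((1 - jacobian P s l r) *ᵥ fun Y : s => d Y) X =
      ∑ α ∈ P X, (leibnizSum l r d α - ∑ Y ∈ s, leibnizSum l r (Pi.single Y 1) α * d Y) := by
    rw [sub_mulVec, one_mulVec, Pi.sub_apply, hd X X.2, Finset.sum_sub_distrib, Finset.sum_comm]
    simp only [mulVec, dotProduct, jacobian, of_apply, Finset.sum_mul]
    rw [← Finset.sum_coe_sort s]
  rw [mulVec_eq]
  exact sum_mem fun α hα => leibnizSum_sub_sum_mem A hl hr s (hP X X.2 α hα)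

end LeibnizSum

/-! ### Series of finite rank and lacunary sets -/

section BivariateSeries

open PowerSeries

/-- The power series in two variables (the series in `Y` over `K⟦X⟧`) of finite rank: their
coefficients span a finitely generated submodule of `K⟦X⟧`. Equivalently, they are the finite sums
of products `f(X) * g(Y)`. -/
def finiteRankSeries (K : Type*) [CommRing K] : Subring K⟦X⟧⟦X⟧ where
  carrier := {h | ∃ V : Submodule K K⟦X⟧, V.FG ∧ ∀ j, coeff j h ∈ V}
  zero_mem' := ⟨⊥, Submodule.fg_bot, by simp⟩
  one_mem' := by
    refine ⟨K ∙ 1, Submodule.fg_span_singleton _, fun j => ?_⟩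
    rw [coeff_one]
    split_ifs
    · exact Submodule.mem_span_singleton_self _
    · exact zero_mem _
  add_mem' := by
    rintro f g ⟨V, hV, hf⟩ ⟨W, hW, hg⟩
    refine ⟨V ⊔ W, hV.sup hW, fun j => ?_⟩
    rw [map_add]
    exact Submodule.add_mem_sup (hf j) (hg j)
  neg_mem' := by
    rintro f ⟨V, hV, hf⟩
    exact ⟨V, hV, fun j => by rw [map_neg]; exact neg_mem (hf j)⟩
  mul_mem' := by
    rintro f g ⟨V, hV, hf⟩ ⟨W, hW, hg⟩
    refine ⟨V * W, hV.mul hW, fun j => ?_⟩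
    rw [coeff_mul]
    exact sum_mem fun p _ => Submodule.mul_mem_mul (hf _) (hg _)

variable {K : Type*} [CommRing K]

theorem C_mem_finiteRankSeries (f : K⟦X⟧) : C f ∈ finiteRankSeries K := by
  refine ⟨K ∙ f, Submodule.fg_span_singleton _, fun j => ?_⟩
  rw [coeff_C]
  split_ifs
  · exact Submodule.mem_span_singleton_self _
  · exact zero_mem _

theorem map_C_mem_finiteRankSeries (f : K⟦X⟧) : map C f ∈ finiteRankSeries K := by
  refine ⟨K ∙ 1, Submodule.fg_span_singleton _, fun j => ?_⟩
  rw [coeff_map, ← mul_one (C _), ← smul_eq_C_mul]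
  exact Submodule.smul_mem _ _ (Submodule.mem_span_singleton_self _)

theorem X_mem_finiteRankSeries : (X : K⟦X⟧⟦X⟧) ∈ finiteRankSeries K :=
  map_X (C : K →+* K⟦X⟧) ▸ map_C_mem_finiteRankSeries X

theorem exists_X_pow_dvd_imp_eq_zero [IsArtinianRing K] {V : Submodule K K⟦X⟧} (hV : V.FG) :
    ∃ M : ℕ, ∀ w ∈ V, X ^ M ∣ w → w = 0 := by
  have := Module.Finite.iff_fg.2 hV
  let filtration : ℕ →o (Submodule K V)ᵒᵈ :=
    { toFun n := OrderDual.toDual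
        (((Ideal.span {X ^ n}).restrictScalars K : Submodule K K⟦X⟧).comap V.subtype)
      monotone' m n hmn w hw := Ideal.mem_span_singleton.2
        ((pow_dvd_pow X hmn).trans (Ideal.mem_span_singleton.1 hw)) }
  obtain ⟨M, hM⟩ := IsArtinian.monotone_stabilizes filtration
  refine ⟨M, fun w hwV hw => PowerSeries.ext fun n => ?_⟩
  have hn : (⟨w, hwV⟩ : V) ∈ OrderDual.ofDual (filtration (max M (n + 1))) := by
    rw [← hM _ (le_max_left _ _)]
    exact Ideal.mem_span_singleton.2 hw
  exact X_pow_dvd_iff.1 (Ideal.mem_span_singleton.1 hn) n (by omega)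

/-- The linear map sending a family of power series `f j ∈ V`, `j ∈ S`, to `∑ j, X ^ j * f j`. -/
noncomputable def shiftedSum (S : Set ℕ) (V : Submodule K K⟦X⟧) : (S →₀ V) →ₗ[K] K⟦X⟧ :=
  Finsupp.lsum K fun j => LinearMap.mulLeft K (X ^ j.1) ∘ₗ V.subtype

theorem shiftedSum_single {S : Set ℕ} {V : Submodule K K⟦X⟧} (j : S) (w : V) :
    shiftedSum S V (Finsupp.single j w) = X ^ j.1 * w.1 := by
  simp [shiftedSum]

theorem shiftedSum_injective {S : Set ℕ} {V : Submodule K K⟦X⟧} {M : ℕ}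
    (hS : ∀ i ∈ S, ∀ j ∈ S, i < j → i + M ≤ j) (hV : ∀ w ∈ V, X ^ M ∣ w → w = 0) :
    Function.Injective (shiftedSum S V) := by
  refine (injective_iff_map_eq_zero _).2 fun f hf => ?_
  by_contra hf0
  have hne := Finsupp.support_nonempty_iff.2 hf0
  set i := f.support.min' hne
  have hi : i ∈ f.support := f.support.min'_mem hne
  have hsum : X ^ i.1 * (f i).1 + ∑ j ∈ f.support.erase i, X ^ j.1 * (f j).1 = 0 := by
    rw [Finset.add_sum_erase _ (fun j : S => X ^ j.1 * (f j).1) hi]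
    simpa [shiftedSum, Finsupp.sum] using hf
  have dvd_rest : X ^ (i.1 + M) ∣ ∑ j ∈ f.support.erase i, X ^ j.1 * (f j).1 := by
    refine Finset.dvd_sum fun j hj => Dvd.dvd.mul_right (pow_dvd_pow _ (hS i i.2 j j.2 ?_)) _
    exact f.support.min'_lt_of_mem_erase_min' hne hj
  have dvd_first : X ^ M ∣ (f i).1 := by
    obtain ⟨g, hg⟩ := dvd_rest
    refine ⟨-g, X_pow_mul_cancel (k := i.1) ?_⟩
    rw [eq_neg_of_add_eq_zero_left hsum, hg, pow_add]
    ring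
  exact Finsupp.mem_support_iff.1 hi (Subtype.ext (hV _ (f i).2 dvd_first))

theorem exists_finset_support_subset {R ι N : Type*} [Semiring R] [AddCommMonoid N] [Module R N]
    {U : Submodule R (ι →₀ N)} (hU : U.FG) : ∃ s : Finset ι, ∀ f ∈ U, f.support ⊆ s := by
  classical
  obtain ⟨G, rfl⟩ := hU
  have hle : Submodule.span R (G : Set (ι →₀ N)) ≤
      Finsupp.supported N R (G.biUnion Finsupp.support : Set ι) :=
    Submodule.span_le.2 fun g hg => Finset.coe_subset.2 (Finset.subset_biUnion_of_mem _ hg)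
  exact ⟨_, fun f hf => Finset.coe_subset.1 (hle hf)⟩

/-- The power series `∑ j ∈ S, X ^ j * Y ^ j`. -/
noncomputable def diagonalSeries (K : Type*) [CommRing K] (S : Set ℕ) : K⟦X⟧⟦X⟧ :=
  .mk (S.indicator (X ^ ·))

theorem diagonalSeries_mem_of_finite {S : Set ℕ} (hS : S.Finite) :
    diagonalSeries K S ∈ finiteRankSeries K := by
  refine ⟨.span K ((X ^ ·) '' S), Submodule.fg_span (hS.image _), fun j => ?_⟩
  rw [diagonalSeries, coeff_mk]
  by_cases hj : j ∈ S
  · rw [Set.indicator_of_mem hj]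
    exact Submodule.subset_span ⟨j, hj, rfl⟩
  · rw [Set.indicator_of_notMem hj]
    exact zero_mem _

theorem diagonalSeries_diff_add {S B : Set ℕ} (hB : B ⊆ S) :
    diagonalSeries K (S \ B) + diagonalSeries K B = diagonalSeries K S := by
  ext1 j
  by_cases hj : j ∈ B
  · simp [diagonalSeries, hj, hB hj]
  · by_cases hjS : j ∈ S <;> simp [diagonalSeries, hj, hjS]

theorem exists_shiftedSum_eq_coeff_mul_diagonalSeries {S : Set ℕ} {V : Submodule K K⟦X⟧}
    {D : K⟦X⟧⟦X⟧} (hD : ∀ i, coeff i D ∈ V) (m : ℕ) :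
    ∃ f : S →₀ V, shiftedSum S V f = coeff m (D * diagonalSeries K S) ∧
      ∀ i, ∀ j : S, i + j = m → (f j : K⟦X⟧) = coeff i D := by
  classical
  refine ⟨∑ p ∈ Finset.HasAntidiagonal.antidiagonal m,
    if hp : p.2 ∈ S then Finsupp.single ⟨p.2, hp⟩ ⟨coeff p.1 D, hD p.1⟩ else 0, ?_, ?_⟩
  · rw [map_sum, coeff_mul]
    refine Finset.sum_congr rfl fun p _ => ?_
    by_cases hp : p.2 ∈ S
    · simp [hp, shiftedSum_single, diagonalSeries, mul_comm]
    · simp [hp, diagonalSeries]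
  · rintro i j rfl
    rw [Finsupp.finsetSum_apply, Finset.sum_eq_single (i, j.1)]
    · simp
    · rintro ⟨k, l⟩ hkl hne
      dsimp only
      split_ifs with hl
      · refine Finsupp.single_eq_of_ne fun hjl => hne ?_
        subst hjl
        simpa using hkl
      · rfl
    · simp

theorem mul_diagonalSeries_notMem_of_separated [IsNoetherianRing K] {S : Set ℕ} (hS : S.Infinite)
    {M : ℕ} (hsep : ∀ i ∈ S, ∀ j ∈ S, i < j → i + M ≤ j) {V : Submodule K K⟦X⟧}
    (hV : ∀ w ∈ V, X ^ M ∣ w → w = 0) {D : K⟦X⟧⟦X⟧} (hD : ∀ i, coeff i D ∈ V) (hD0 : D ≠ 0) :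
    D * diagonalSeries K S ∉ finiteRankSeries K := by
  rintro ⟨W, hW, hDW⟩
  have := hS.to_subtype
  have comap_fg : (W.comap (shiftedSum S V)).FG :=
    Submodule.fg_of_fg_map_injective _ (shiftedSum_injective hsep hV)
      (hW.of_le (Submodule.map_comap_le _ _))
  obtain ⟨s, hs⟩ := exists_finset_support_subset comap_fg
  obtain ⟨i, hi⟩ : ∃ i, coeff i D ≠ 0 := by
    by_contra! h
    exact hD0 (PowerSeries.ext h)
  obtain ⟨j, hj⟩ := Infinite.exists_notMem_finset s
  obtain ⟨f, hf, hfD⟩ := exists_shiftedSum_eq_coeff_mul_diagonalSeries hD (i + j)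
  refine hj (hs f ?_ ?_)
  · rw [Submodule.mem_comap, hf]
    exact hDW _
  · rw [Finsupp.mem_support_iff, Ne, ← Subtype.coe_inj, hfD i j rfl]
    exact hi

/-- A set of natural numbers is lacunary if the gaps between its consecutive elements tend to
infinity: for each `M`, only finitely many elements are followed by another one at a distance less
than `M`. -/
def IsLacunary (S : Set ℕ) : Prop :=
  ∀ M, {i ∈ S | ∃ j ∈ S, i < j ∧ j < i + M}.Finite

theorem isLacunary_range_two_pow : IsLacunary (Set.range (2 ^ ·)) := by
  refine fun M => (Set.finite_Iio M).subset ?_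
  rintro _ ⟨⟨m, rfl⟩, _, ⟨n, rfl⟩, hlt, hM⟩
  have : 2 ^ (m + 1) ≤ 2 ^ n :=
    Nat.pow_le_pow_right two_pos ((Nat.pow_lt_pow_iff_right one_lt_two).1 hlt)
  rw [pow_succ] at this
  change 2 ^ m < M
  dsimp only at hM
  omega

theorem IsLacunary.mul_diagonalSeries_notMem [IsArtinianRing K] {S : Set ℕ} (hlac : IsLacunary S)
    (hS : S.Infinite) {D : K⟦X⟧⟦X⟧} (hD : D ∈ finiteRankSeries K) (hD0 : D ≠ 0) :
    D * diagonalSeries K S ∉ finiteRankSeries K := by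
  intro hmem
  obtain ⟨V, hV, hDV⟩ := id hD
  obtain ⟨M, hM⟩ := exists_X_pow_dvd_imp_eq_zero hV
  set B := {i ∈ S | ∃ j ∈ S, i < j ∧ j < i + M}
  have separated : ∀ i ∈ S \ B, ∀ j ∈ S \ B, i < j → i + M ≤ j := fun i hi j hj hij =>
    not_lt.1 fun h => hi.2 ⟨hi.1, j, hj.1, hij, h⟩
  refine mul_diagonalSeries_notMem_of_separated (hS.sdiff (hlac M)) separated hM hDV hD0 ?_
  rw [eq_sub_of_add_eq (diagonalSeries_diff_add (K := K) (Set.sep_subset S _ : B ⊆ S)), mul_sub]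
  exact sub_mem hmem (mul_mem hD (diagonalSeries_mem_of_finite (hlac M)))

end BivariateSeries

/-! ### Counting parse forests -/

namespace GF2Grammar

variable {T : Type*} {G : ContextFreeGrammar T}

/-- The decomposition of a parse forest into its first tree and the remaining forest. -/
def consEquiv (X : Symbol T G.NT) (α : List (Symbol T G.NT)) :
    G.ParseForest (X :: α) ≃ G.ParseForest [X] × G.ParseForest α where
  toFun
    | .leaf t rest => (.leaf t .nil, rest)
    | .node A γ h children rest => (.node A γ h children .nil, rest)
  invFun
    | (.leaf t .nil, rest) => .leaf t rest
    | (.node A γ h children .nil, rest) => .node A γ h children rest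
  left_inv
    | .leaf _ _ => rfl
    | .node _ _ _ _ _ => rfl
  right_inv
    | (.leaf _ .nil, _) => rfl
    | (.node _ _ _ _ .nil, _) => rfl

theorem yield_consEquiv_symm {X : Symbol T G.NT} {α : List (Symbol T G.NT)} :
    ∀ (f : G.ParseForest [X]) (g : G.ParseForest α),
      ((consEquiv X α).symm (f, g)).yield = f.yield ++ g.yield
  | .leaf _ .nil, _ => rfl
  | .node _ _ _ children .nil, g => by
    change children.yield ++ g.yield = (children.yield ++ []) ++ g.yield
    rw [List.append_nil]

/-- The number of internal nodes of a parse forest. -/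
def size : {α : List (Symbol T G.NT)} → G.ParseForest α → ℕ
  | _, .nil => 0
  | _, .leaf _ rest => size rest
  | _, .node _ _ _ children rest => size children + size rest + 1

theorem size_consEquiv_symm {X : Symbol T G.NT} {α : List (Symbol T G.NT)} :
    ∀ (f : G.ParseForest [X]) (g : G.ParseForest α),
      size ((consEquiv X α).symm (f, g)) = size f + size g
  | .leaf _ .nil, g => (Nat.zero_add (size g)).symm
  | .node _ _ _ children .nil, g => Nat.add_right_comm (size children) (size g) 1

section Counting

/-- The number of parse forests over the sentential form `α` that yield `w`, which is the junk value
`0` if there are infinitely many of them. -/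
noncomputable def forestCount (G : ContextFreeGrammar T) (α : List (Symbol T G.NT))
    (w : List T) : ℕ :=
  Nat.card {f : G.ParseForest α // f.yield = w}

/-- A sentential form is trim if it has parse forests, but only finitely many with a given yield. -/
structure IsTrim (G : ContextFreeGrammar T) (α : List (Symbol T G.NT)) : Prop where
  nonempty : Nonempty (G.ParseForest α)
  finite (w : List T) : Finite {f : G.ParseForest α // f.yield = w}

theorem exists_yield_eq_of_forestCount_ne_zero {α : List (Symbol T G.NT)} {w : List T}
    (h : forestCount G α w ≠ 0) : ∃ f : G.ParseForest α, f.yield = w :=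
  nonempty_subtype.1 (Nat.card_ne_zero.1 h).1

theorem forestCount_nil_nil : forestCount G [] [] = 1 :=
  Nat.card_eq_one_iff_exists.2 ⟨⟨.nil, rfl⟩, by rintro ⟨_ | _, _⟩; rfl⟩

theorem forestCount_nil_of_ne_nil {w : List T} (hw : w ≠ []) : forestCount G [] w = 0 := by
  by_contra h
  obtain ⟨_ | _, rfl⟩ := exists_yield_eq_of_forestCount_ne_zero h
  exact hw rfl

theorem forestCount_terminal_of_length_ne_one (t : T) {w : List T} (hw : w.length ≠ 1) :
    forestCount G [.terminal t] w = 0 := by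
  by_contra h
  obtain ⟨_ | ⟨_, _ | _⟩ | _, rfl⟩ := exists_yield_eq_of_forestCount_ne_zero h
  exact hw rfl

variable {X : Symbol T G.NT} {α : List (Symbol T G.NT)}

theorem IsTrim.of_injective {β : List (Symbol T G.NT)} (h : IsTrim G β)
    (hne : Nonempty (G.ParseForest α)) {φ : G.ParseForest α → G.ParseForest β}
    (hφ : φ.Injective) (u : List T → List T) (hu : ∀ f, (φ f).yield = u f.yield) :
    IsTrim G α := by
  refine ⟨hne, fun w => ?_⟩
  have := h.finite (u w)
  exact .of_injective
    (β := {g : G.ParseForest β // g.yield = u w}) (fun f => ⟨φ f.1, by rw [hu, f.2]⟩)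
    fun f f' hff' => Subtype.ext (hφ (Subtype.ext_iff.1 hff'))

theorem IsTrim.head (h : IsTrim G (X :: α)) : IsTrim G [X] := by
  obtain ⟨f, g⟩ := consEquiv X α h.nonempty.some
  refine h.of_injective ⟨f⟩ (φ := fun f => (consEquiv X α).symm (f, g)) (fun f f' hff' => ?_)
    (· ++ g.yield) (yield_consEquiv_symm · g)
  simpa using hff'

theorem IsTrim.tail (h : IsTrim G (X :: α)) : IsTrim G α := by
  obtain ⟨f, g⟩ := consEquiv X α h.nonempty.some
  refine h.of_injective ⟨g⟩ (φ := fun g => (consEquiv X α).symm (f, g)) (fun g g' hgg' => ?_)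
    (f.yield ++ ·) (yield_consEquiv_symm f)
  simpa using hgg'

theorem IsTrim.of_mem (h : IsTrim G α) (hX : X ∈ α) : IsTrim G [X] := by
  induction α with
  | nil => cases hX
  | cons Y α ih =>
    rcases List.mem_cons.1 hX with rfl | hX
    · exact h.head
    · exact ih h.tail hX

theorem forestCount_cons (h : IsTrim G (X :: α)) (w : List T) :
    forestCount G (X :: α) w = ∑ k ∈ Finset.range (w.length + 1),
      forestCount G [X] (w.take k) * forestCount G α (w.drop k) := by
  have := h.head.finite
  have := h.tail.finite
  let join (p : Σ k : Fin (w.length + 1), {f : G.ParseForest [X] // f.yield = w.take k} ×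
      {g : G.ParseForest α // g.yield = w.drop k}) : {f : G.ParseForest (X :: α) // f.yield = w} :=
    ⟨(consEquiv X α).symm (p.2.1, p.2.2), by
      rw [yield_consEquiv_symm, p.2.1.2, p.2.2.2, List.take_append_drop]⟩
  have join_bijective : join.Bijective := by
    constructor
    · rintro ⟨k, ⟨f, hf⟩, g, hg⟩ ⟨k', ⟨f', hf'⟩, g', hg'⟩ hp
      obtain ⟨rfl, rfl⟩ : f = f' ∧ g = g' := by simpa [join] using hp
      obtain rfl : k = k' := Fin.ext <| by
        simpa [Nat.lt_succ_iff.1 k.2, Nat.lt_succ_iff.1 k'.2] using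
          congrArg List.length (hf.symm.trans hf')
      rfl
    · rintro ⟨f, rfl⟩
      obtain ⟨⟨f, g⟩, rfl⟩ := (consEquiv X α).symm.surjective f
      refine ⟨⟨⟨f.yield.length, ?_⟩, ⟨f, ?_⟩, g, ?_⟩, rfl⟩ <;>
        simp [yield_consEquiv_symm]
  simp only [forestCount, ← Nat.card_eq_of_bijective join join_bijective, Nat.card_sigma,
    Nat.card_prod, Finset.sum_range]

theorem forestCount_cons_append (h : IsTrim G (X :: α)) (u v : List T) :
    forestCount G (X :: α) (u ++ v) =
      ∑ k ∈ Finset.range (u.length + 1),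
        forestCount G [X] (u.take k) * forestCount G α (u.drop k ++ v) +
      ∑ l ∈ Finset.range v.length,
        forestCount G [X] (u ++ v.take (l + 1)) * forestCount G α (v.drop (l + 1)) := by
  rw [forestCount_cons h, List.length_append, add_right_comm, Finset.sum_range_add]
  congr 1
  · refine Finset.sum_congr rfl fun k hk => ?_
    have hk : k ≤ u.length := Nat.lt_succ_iff.1 (Finset.mem_range.1 hk)
    rw [List.take_append_of_le_length hk, List.drop_append_of_le_length hk]
  · simp only [add_right_comm _ 1, add_assoc, List.take_length_add_append,
      List.drop_length_add_append]

open scoped Classical in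
/-- The right-hand sides of the rules for the symbol `X` that occur in parse trees. -/
noncomputable def productions (G : ContextFreeGrammar T) (X : Symbol T G.NT) :
    Finset (List (Symbol T G.NT)) :=
  {ρ ∈ G.rules | .nonterminal ρ.input = X ∧ Nonempty (G.ParseForest ρ.output)}.image
    ContextFreeRule.output

theorem mem_productions {A : G.NT} :
    α ∈ productions G (.nonterminal A) ↔ ⟨A, α⟩ ∈ G.rules ∧ Nonempty (G.ParseForest α) := by
  classical
  simp only [productions, Finset.mem_image, Finset.mem_filter]
  constructor
  · rintro ⟨⟨_, _⟩, ⟨hρ, ⟨⟩, hne⟩, rfl⟩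
    exact ⟨hρ, hne⟩
  · exact fun ⟨hρ, hne⟩ => ⟨⟨A, α⟩, ⟨hρ, rfl, hne⟩, rfl⟩

theorem IsTrim.of_mem_productions {A : G.NT} (h : IsTrim G [.nonterminal A])
    (hα : α ∈ productions G (.nonterminal A)) : IsTrim G α := by
  obtain ⟨hρ, hne⟩ := mem_productions.1 hα
  refine h.of_injective hne (φ := fun f => .node A α hρ f .nil) (fun f f' hff' => ?_) id
    fun f => List.append_nil f.yield
  simpa using hff'

theorem forestCount_nonterminal {A : G.NT} (h : IsTrim G [.nonterminal A]) (w : List T) :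
    forestCount G [.nonterminal A] w =
      ∑ α ∈ productions G (.nonterminal A), forestCount G α w := by
  have (α : productions G (.nonterminal A)) := (h.of_mem_productions α.2).finite w
  let root (p : Σ α : productions G (.nonterminal A), {f : G.ParseForest α // f.yield = w}) :
      {f : G.ParseForest [.nonterminal A] // f.yield = w} :=
    ⟨.node A p.1 (mem_productions.1 p.1.2).1 p.2.1 .nil, (List.append_nil _).trans p.2.2⟩
  have root_bijective : root.Bijective := by
    constructor
    · rintro ⟨⟨α, hα⟩, f, hf⟩ ⟨⟨α', hα'⟩, f', hf'⟩ hp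
      cases hp
      rfl
    · rintro ⟨_ | _ | ⟨_, α, hρ, f, _ | _⟩, hw⟩
      exact ⟨⟨⟨α, mem_productions.2 ⟨hρ, ⟨f⟩⟩⟩, f, (List.append_nil _).symm.trans hw⟩, rfl⟩
  rw [forestCount, ← Nat.card_eq_of_bijective root root_bijective, Nat.card_sigma]
  exact Finset.sum_coe_sort _ fun α => forestCount G α w

open scoped Classical in
/-- The nonterminals of `G` that are trim as sentential forms. -/
noncomputable def trimSymbols (G : ContextFreeGrammar T) : Finset (Symbol T G.NT) :=
  {X ∈ G.rules.image fun ρ => .nonterminal ρ.input | IsTrim G [X]}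

theorem mem_trimSymbols {A : G.NT} :
    .nonterminal A ∈ trimSymbols G ↔ IsTrim G [.nonterminal A] := by
  classical
  rw [trimSymbols, Finset.mem_filter, and_iff_right_iff_imp]
  rintro ⟨⟨_ | _ | ⟨_, α, hρ, -, -⟩⟩, -⟩
  exact Finset.mem_image_of_mem _ hρ

theorem exists_of_mem_trimSymbols (hX : X ∈ trimSymbols G) :
    ∃ A, X = .nonterminal A ∧ IsTrim G [.nonterminal A] := by
  classical
  obtain ⟨hX, htrim⟩ := Finset.mem_filter.1 hX
  obtain ⟨ρ, -, rfl⟩ := Finset.mem_image.1 hX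
  exact ⟨ρ.input, rfl, htrim⟩

end Counting

section Series

open PowerSeries

variable (K : Type*) [CommRing K]

/-- The series `∑ n, N n * X ^ n`, where `N n` is the number of parse forests over `α` with yield
`c ^ n`. -/
noncomputable def unarySeries (c : T) (α : List (Symbol T G.NT)) : K⟦X⟧ :=
  .mk fun n => (forestCount G α (.replicate n c) : K)

/-- The series `∑ i j, N i j * X ^ i * Y ^ j`, where `N i j` is the number of parse forests over `α`
with yield `a ^ i * b ^ j`. -/
noncomputable def binarySeries (a b : T) (α : List (Symbol T G.NT)) : K⟦X⟧⟦X⟧ :=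
  .mk fun j => .mk fun i => (forestCount G α (.replicate i a ++ .replicate j b) : K)

/-- The part of `binarySeries` that comes from the strings containing `b`, divided by `Y`. -/
noncomputable def mixedSeries (a b : T) (α : List (Symbol T G.NT)) : K⟦X⟧⟦X⟧ :=
  .mk fun j => .mk fun i => (forestCount G α (.replicate i a ++ .replicate (j + 1) b) : K)

variable {K} {a b : T} {X : Symbol T G.NT} {α : List (Symbol T G.NT)}

theorem binarySeries_eq : binarySeries K a b α =
    mixedSeries K a b α * PowerSeries.X + C (unarySeries K a α) := by
  rw [eq_shift_mul_X_add_const (binarySeries K a b α)]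
  simp [binarySeries, unarySeries, mixedSeries]

theorem mixedSeries_terminal_mem (t : T) :
    mixedSeries (G := G) K a b [.terminal t] ∈ finiteRankSeries K := by
  have eq_C : mixedSeries (G := G) K a b [.terminal t] =
      C (coeff 0 (mixedSeries (G := G) K a b [.terminal t])) := by
    ext j i
    rcases j with _ | j
    · simp
    · have hlen : (.replicate i a ++ .replicate (j + 1 + 1) b : List T).length ≠ 1 := by
        rw [List.length_append, List.length_replicate, List.length_replicate]
        omega
      simp [mixedSeries, forestCount_terminal_of_length_ne_one t hlen]
  rw [eq_C]
  exact C_mem_finiteRankSeries _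

theorem unarySeries_cons (c : T) (h : IsTrim G (X :: α)) :
    unarySeries K c (X :: α) = unarySeries K c [X] * unarySeries K c α := by
  ext n
  simp only [unarySeries, coeff_mk, coeff_mul, forestCount_cons h, List.length_replicate,
    List.take_replicate, List.drop_replicate, Nat.cast_sum, Nat.cast_mul]
  rw [Finset.Nat.sum_antidiagonal_eq_sum_range_succ
    fun k l => (forestCount G [X] (.replicate k c) * forestCount G α (.replicate l c) : K)]
  refine Finset.sum_congr rfl fun k hk => ?_
  rw [min_eq_left (Nat.lt_succ_iff.1 (Finset.mem_range.1 hk))]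

theorem unarySeries_eq_prod (c : T) (h : IsTrim G α) :
    unarySeries K c α = (α.map fun X => unarySeries K c [X]).prod := by
  induction α with
  | nil =>
    ext n
    rcases n with _ | n <;>
      simp [unarySeries, coeff_one, forestCount_nil_nil, forestCount_nil_of_ne_nil]
  | cons X α ih => rw [unarySeries_cons c h, ih h.tail, List.map_cons, List.prod_cons]

theorem mixedSeries_cons (h : IsTrim G (X :: α)) :
    mixedSeries K a b (X :: α) = C (unarySeries K a [X]) * mixedSeries K a b α +
      mixedSeries K a b [X] * map C (unarySeries K b α) := by
  ext j i
  rw [map_add, map_add, coeff_C_mul, coeff_mul, coeff_mul, map_sum,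
    Finset.Nat.sum_antidiagonal_eq_sum_range_succ_mk,
    Finset.Nat.sum_antidiagonal_eq_sum_range_succ_mk]
  simp only [mixedSeries, unarySeries, coeff_mk, coeff_map, coeff_mul_C, forestCount_cons_append h,
    List.length_replicate, List.take_replicate, List.drop_replicate, Nat.cast_add, Nat.cast_sum,
    Nat.cast_mul, Nat.add_sub_add_right]
  congr 1 <;> refine Finset.sum_congr rfl fun k hk => ?_ <;>
    rw [min_eq_left (by simpa [Nat.lt_succ_iff] using hk)]

theorem mixedSeries_eq_leibnizSum (h : IsTrim G α) :
    mixedSeries K a b α = leibnizSum (fun X => C (unarySeries K a [X]))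
      (fun X => map C (unarySeries K b [X])) (fun X => mixedSeries K a b [X]) α := by
  induction α with
  | nil =>
    ext j i
    simp [mixedSeries, leibnizSum, forestCount_nil_of_ne_nil]
  | cons X α ih =>
    rw [mixedSeries_cons h, ih h.tail, unarySeries_eq_prod b h.tail, map_list_prod, List.map_map]
    rfl

theorem mixedSeries_nonterminal {A : G.NT} (h : IsTrim G [.nonterminal A]) :
    mixedSeries K a b [.nonterminal A] =
      ∑ α ∈ productions G (.nonterminal A), mixedSeries K a b α := by
  ext j i
  simp [mixedSeries, forestCount_nonterminal h]

end Series

section Ambiguity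

variable {K : Type*} [CommRing K]

theorem exists_yield_eq_nil {α : List (Symbol T G.NT)}
    (h : ∀ X ∈ α, ∃ f : G.ParseForest [X], f.yield = []) : ∃ f : G.ParseForest α, f.yield = [] := by
  induction α with
  | nil => exact ⟨.nil, rfl⟩
  | cons X α ih =>
    rw [List.forall_mem_cons] at h
    obtain ⟨f, hf⟩ := h.1
    obtain ⟨g, hg⟩ := ih h.2
    exact ⟨(consEquiv X α).symm (f, g), by rw [yield_consEquiv_symm, hf, hg, List.append_nil]⟩

theorem exists_yield_eq_of_leibnizSum_ne_zero [DecidableEq (Symbol T G.NT)] {e : Symbol T G.NT → K}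
    (he : ∀ X, e X ≠ 0 → ∃ f : G.ParseForest [X], f.yield = []) {Y : Symbol T G.NT}
    (g : G.ParseForest [Y]) {α : List (Symbol T G.NT)}
    (hα : leibnizSum e e (Pi.single Y 1) α ≠ 0) :
    ∃ f : G.ParseForest α, f.yield = g.yield ∧ size g ≤ size f := by
  induction α with
  | nil => exact absurd rfl hα
  | cons X α ih =>
    rw [leibnizSum] at hα
    by_cases h : e X * leibnizSum e e (Pi.single Y 1) α ≠ 0
    · obtain ⟨f₀, hf₀⟩ := he X (left_ne_zero_of_mul h)
      obtain ⟨f, hf, hle⟩ := ih (right_ne_zero_of_mul h)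
      refine ⟨(consEquiv X α).symm (f₀, f), ?_, ?_⟩
      · rw [yield_consEquiv_symm, hf₀, hf, List.nil_append]
      · rw [size_consEquiv_symm]
        exact hle.trans (Nat.le_add_left _ _)
    · rw [not_not.1 h, zero_add] at hα
      obtain rfl : X = Y := by
        by_contra hXY
        simp [hXY] at hα
      obtain ⟨f₀, hf₀⟩ := exists_yield_eq_nil fun Z hZ => he Z fun hZ0 =>
        right_ne_zero_of_mul hα (List.prod_eq_zero (hZ0 ▸ List.mem_map_of_mem hZ))
      refine ⟨(consEquiv X α).symm (g, f₀), ?_, ?_⟩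
      · rw [yield_consEquiv_symm, hf₀, List.append_nil]
      · rw [size_consEquiv_symm]
        exact Nat.le_add_right _ _

theorem exists_size_lt_of_jacobian_ne_zero [DecidableEq (Symbol T G.NT)]
    {e : Symbol T G.NT → K} (he : ∀ X, e X ≠ 0 → ∃ f : G.ParseForest [X], f.yield = [])
    {X Y : trimSymbols G} (hXY : jacobian (productions G) (trimSymbols G) e e X Y ≠ 0)
    (g : G.ParseForest [Y.1]) :
    ∃ f : G.ParseForest [X.1], f.yield = g.yield ∧ size g < size f := by
  obtain ⟨α, hα, hne⟩ := Finset.exists_ne_zero_of_sum_ne_zero hXY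
  obtain ⟨f, hf, hle⟩ := exists_yield_eq_of_leibnizSum_ne_zero he g hne
  obtain ⟨X, hX⟩ := X
  obtain ⟨A, rfl, -⟩ := exists_of_mem_trimSymbols hX
  exact ⟨.node A α (mem_productions.1 hα).1 f .nil, by rw [← hf]; exact List.append_nil _,
    Nat.lt_succ_of_le hle⟩

theorem det_one_sub_jacobian_ne_zero [IsDomain K] [DecidableEq (Symbol T G.NT)]
    {e : Symbol T G.NT → K} (he : ∀ X, e X ≠ 0 → ∃ f : G.ParseForest [X], f.yield = []) :
    (1 - jacobian (productions G) (trimSymbols G) e e).det ≠ 0 := by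
  have htrim (X : trimSymbols G) : IsTrim G [X.1] := by
    obtain ⟨A, hA, h⟩ := exists_of_mem_trimSymbols X.2
    exact hA ▸ h
  let W : Set (List T) := Set.range fun X => (htrim X).nonempty.some.yield
  have W_finite : W.Finite := Set.finite_range _
  have exists_largest (X : trimSymbols G) : ∃ f : G.ParseForest [X.1], f.yield ∈ W ∧
      ∀ f' : G.ParseForest [X.1], f'.yield ∈ W → size f' ≤ size f :=
    Set.exists_max_image _ size (W_finite.preimage' fun w _ => (htrim X).finite w)
      ⟨(htrim X).nonempty.some, X, rfl⟩
  choose largest yield_mem size_le using exists_largest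
  refine det_one_sub_ne_zero_of_rank (fun X => size (largest X)) fun X Y hXY => ?_
  obtain ⟨f, hf, hlt⟩ := exists_size_lt_of_jacobian_ne_zero he hXY (largest Y)
  exact hlt.trans_le (size_le X f (hf ▸ yield_mem Y))

end Ambiguity

section LinearSystem

open PowerSeries

variable (G) (K : Type*) [CommRing K] (a b : T)

open scoped Classical in
/-- The determinant of the linear system satisfied by the series `mixedSeries K a b [X]` of the trim
nonterminals `X` of `G`. -/
noncomputable def systemDet : K⟦X⟧⟦X⟧ :=
  (1 - jacobian (productions G) (trimSymbols G) (fun X => C (unarySeries K a [X]))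
    (fun X => map C (unarySeries K b [X]))).det

theorem systemDet_mem : systemDet G K a b ∈ finiteRankSeries K := by
  classical
  exact det_mem_subring _ <| one_sub_jacobian_mem _ _ _ (fun _ => C_mem_finiteRankSeries _)
    (fun _ => map_C_mem_finiteRankSeries _)

theorem systemDet_ne_zero [IsDomain K] : systemDet G K a b ≠ 0 := by
  classical
  let e (X : Symbol T G.NT) : K := forestCount G [X] []
  have he (X) (hX : e X ≠ 0) : ∃ f : G.ParseForest [X], f.yield = [] :=
    exists_yield_eq_of_forestCount_ne_zero fun h => hX (by simp only [e, h, Nat.cast_zero])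
  let ε : K⟦X⟧⟦X⟧ →+* K := constantCoeff.comp constantCoeff
  have ε_left : (ε ∘ fun X => C (unarySeries K a [X])) = e := by
    ext X
    simp [ε, e, unarySeries]
  have ε_right : (ε ∘ fun X => map C (unarySeries K b [X])) = e := by
    ext X
    simp only [ε, e, unarySeries, Function.comp_apply, RingHom.comp_apply,
      ← coeff_zero_eq_constantCoeff_apply, coeff_map, coeff_zero_C, coeff_mk, List.replicate_zero]
  refine fun h => det_one_sub_jacobian_ne_zero he ?_
  have map_systemDet := map_det_one_sub_jacobian ε (productions G) (trimSymbols G)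
    (fun X => C (unarySeries K a [X])) (fun X => map C (unarySeries K b [X]))
  rw [ε_left, ε_right] at map_systemDet
  exact map_systemDet.symm.trans ((congrArg ε h).trans (map_zero ε))

variable {G K a b} {A : G.NT}

theorem systemDet_mul_mixedSeries_mem (hA : IsTrim G [.nonterminal A]) :
    systemDet G K a b * mixedSeries K a b [.nonterminal A] ∈ finiteRankSeries K := by
  classical
  refine det_one_sub_jacobian_mul_mem _ (fun _ => C_mem_finiteRankSeries _)
    (fun _ => map_C_mem_finiteRankSeries _) (d := fun X => mixedSeries K a b [X])
    (fun X hX => ?_) (fun X hX α hα Y hY hYs => ?_) (mem_trimSymbols.2 hA)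
  · obtain ⟨A, rfl, hA⟩ := exists_of_mem_trimSymbols hX
    exact (mixedSeries_nonterminal hA).trans <| Finset.sum_congr rfl fun α hα =>
      mixedSeries_eq_leibnizSum (hA.of_mem_productions hα)
  · obtain ⟨A, rfl, hA⟩ := exists_of_mem_trimSymbols hX
    rcases Y with t | B
    · exact mixedSeries_terminal_mem t
    · exact absurd (mem_trimSymbols.2 ((hA.of_mem_productions hα).of_mem hY)) hYs

theorem systemDet_mul_binarySeries_mem (hA : IsTrim G [.nonterminal A]) :
    systemDet G K a b * binarySeries K a b [.nonterminal A] ∈ finiteRankSeries K := by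
  rw [binarySeries_eq, mul_add, ← mul_assoc]
  exact add_mem (mul_mem (systemDet_mul_mixedSeries_mem hA) X_mem_finiteRankSeries)
    (mul_mem (systemDet_mem G K a b) (C_mem_finiteRankSeries _))

end LinearSystem

theorem forestCount_zmod_two_eq_ite {G : GF2Grammar T} {w : List T} [Decidable (w ∈ G.language)] :
    (forestCount G.toContextFreeGrammar [.nonterminal G.initial] w : ZMod 2) =
      if w ∈ G.language then 1 else 0 := by
  split_ifs with h
  · exact ZMod.natCast_eq_one_iff_odd.2 h
  · exact ZMod.natCast_eq_zero_iff_even.2 (Nat.not_odd_iff_even.1 h)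

theorem isTrim_initial {G : GF2Grammar T} {w : List T} (hw : w ∈ G.language) :
    IsTrim G.toContextFreeGrammar [.nonterminal G.initial] := by
  obtain ⟨f, -⟩ := exists_yield_eq_of_forestCount_ne_zero (Nat.ne_of_odd_add hw)
  exact ⟨⟨f⟩, G.finite_parseTrees⟩

theorem binarySeries_zmod_two_eq_diagonalSeries {a b : T} (hab : a ≠ b) {S : Set ℕ}
    {G : GF2Grammar T}
    (hG : G.language = {w | ∃ n ∈ S, w = .replicate n a ++ .replicate n b}) :
    binarySeries (ZMod 2) a b [.nonterminal G.initial] = diagonalSeries (ZMod 2) S := by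
  classical
  have mem_language (i j : ℕ) :
      .replicate i a ++ .replicate j b ∈ G.language ↔ i = j ∧ j ∈ S := by
    rw [hG]
    constructor
    · rintro ⟨n, hn, h⟩
      have ha : i = n := by simpa [List.count_replicate, hab.symm] using congrArg (List.count a) h
      have hb : j = n := by simpa [List.count_replicate, hab] using congrArg (List.count b) h
      exact ⟨ha.trans hb.symm, hb ▸ hn⟩
    · rintro ⟨rfl, hi⟩
      exact ⟨i, hi, rfl⟩
  ext j i
  simp only [binarySeries, diagonalSeries, PowerSeries.coeff_mk, forestCount_zmod_two_eq_ite,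
    mem_language]
  by_cases hj : j ∈ S <;> simp [hj, PowerSeries.coeff_X_pow]

end GF2Grammar

open GF2Grammar in
theorem theorem3p3_general {T : Type*} {a b : T} (hab : a ≠ b) {S : Set ℕ} (hlac : IsLacunary S)
    (hS : S.Infinite) :
    ¬ Language.IsGF2
      ({w | ∃ n ∈ S, w = List.replicate n a ++ List.replicate n b} : Language T) := by
  rintro ⟨G, hG⟩
  obtain ⟨n, hn⟩ := hS.nonempty
  have htrim : IsTrim G.toContextFreeGrammar [.nonterminal G.initial] :=
    isTrim_initial (hG.symm ▸ ⟨n, hn, rfl⟩ : .replicate n a ++ .replicate n b ∈ G.language)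
  refine hlac.mul_diagonalSeries_notMem hS (systemDet_mem G.toContextFreeGrammar (ZMod 2) a b)
    (systemDet_ne_zero _ _ a b) ?_
  rw [← binarySeries_zmod_two_eq_diagonalSeries hab hG]
  exact systemDet_mul_binarySeries_mem htrim

theorem theorem3p3 {T : Type*} (a b : T) (hab : a ≠ b) :
    ¬ Language.IsGF2
      ({w | ∃ n : ℕ, w = List.replicate (2 ^ n) a ++ List.replicate (2 ^ n) b} : Language T) := by
  simpa only [Set.exists_range_iff] using theorem3p3_general hab isLacunary_range_two_pow
    (Set.infinite_range_of_injective (Nat.pow_right_injective le_rfl))
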